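/- Let $k$ be a field, $n\ge 0$, and let $A=k[X_1,\dots,X_n]$ with its standard grading. For a finitely generated $\mathbb Z$-graded $A$-module $N$ put $$b_i(N)=\max\{\mu\in\mathbb Z \mid \mathrm{Tor}^A_i(N,k)_\mu\neq 0\}\quad(\max\emptyset=-\infty),\qquad \mathrm{reg}(N)=\max_{i\ge 0}\{b_i(N)-i\},$$ where $\mathrm{Tor}^A_i(N,k)_\mu=H_i(X_1,\dots,X_n;N)_\mu$ is the degree-$\mu$ part of the Koszul homology of $N$ with respect to the variables (so $\mathrm{reg}(0)=-\infty$). Let $M$ be a finitely generated $\mathbb Z$-graded $A$-module, let $l\in A$ be a linear form (a homogeneous polynomial of degree $1$, possibly $0$), and let $K=0:_M(l)=\{m\in M\mid lm=0\}$, graded as a submodule of $M$; let $M/lM$ carry the quotient grading. Then $$\mathrm{reg}(M)\le\max\{\mathrm{reg}(K),\mathrm{reg}(M/lM)\}.$$ If moreover the Krull dimension of $A/\mathrm{Ann}_A(K)$ is at most one (which includes the case $K=0$), then $$\mathrm{reg}(M)=\max\{\mathrm{reg}(K),\mathrm{reg}(M/lM)\}.$$ -/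

import Mathlib

open MvPolynomial

universe u v

/-- `ℳ` is a `ℤ`-grading of the module `M` over the polynomial ring `k[x₁, …, xₙ]` with its
standard grading: `M` is the internal direct sum of the subgroups `ℳ i`, and a form of degree `d`
maps `ℳ i` to `ℳ (i + d)`. (Forms of degree `0` are the constants, so every `ℳ i` is a
`k`-subspace.) -/
structure IsModuleGrading {k : Type u} [Field k] {n : ℕ} {M : Type v} [AddCommGroup M]
    [Module (MvPolynomial (Fin n) k) M] (ℳ : ℤ → AddSubgroup M) : Prop where
  isInternal : DirectSum.IsInternal ℳ
  smul_mem : ∀ (d : ℕ) (i : ℤ) (p : MvPolynomial (Fin n) k) (m : M),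
    p.IsHomogeneous d → m ∈ ℳ i → p • m ∈ ℳ (i + d)

section Induced

variable {R : Type u} {M : Type v} [CommRing R] [AddCommGroup M] [Module R M]

/-- The grading induced on a submodule: `N_i = N ∩ M_i`. -/
def Submodule.inducedGrading (N : Submodule R M) (ℳ : ℤ → AddSubgroup M) (i : ℤ) :
    AddSubgroup N :=
  (ℳ i).comap N.subtype.toAddMonoidHom

/-- The grading induced on a quotient: `(M/N)_i` is the image of `M_i`. -/
def Submodule.quotientGrading (N : Submodule R M) (ℳ : ℤ → AddSubgroup M) (i : ℤ) :
    AddSubgroup (M ⧸ N) :=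
  (ℳ i).map N.mkQ.toAddMonoidHom

end Induced

namespace Koszul

variable (k : Type u) [Field k] (n : ℕ) {M : Type v} [AddCommGroup M]
  [Module (MvPolynomial (Fin n) k) M]

/-- The differential of the Koszul complex `K_•(x₁, …, xₙ; M)` on its total module
`⨁_S M e_S`, `S ⊆ {1, …, n}`, an element `∑_S c_S e_S` being written as the function `c`:
`d (m e_S) = ∑_{j ∈ S} (-1)^{#{s ∈ S | s < j}} x_j m e_{S \ {j}}`. -/
noncomputable def differential : (Finset (Fin n) → M) →+ (Finset (Fin n) → M) where
  toFun c T := ∑ j ∈ Tᶜ, (-1 : MvPolynomial (Fin n) k) ^ (T.filter (· < j)).card •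
    (X j : MvPolynomial (Fin n) k) • c (insert j T)
  map_zero' := by
    funext T
    simp
  map_add' c c' := by
    funext T
    simp [smul_add, Finset.sum_add_distrib]

/-- The chains of homological degree `i` and internal degree `μ`: the sums `∑_{#S = i} c_S e_S`
with `c_S ∈ M_{μ - i}` (the basis element `e_S` has internal degree `#S`). -/
def chains (ℳ : ℤ → AddSubgroup M) (i : ℕ) (μ : ℤ) : AddSubgroup (Finset (Fin n) → M) where
  carrier := {c | (∀ S, S.card ≠ i → c S = 0) ∧ ∀ S, c S ∈ ℳ (μ - i)}
  zero_mem' := ⟨fun _ _ => rfl, fun _ => (ℳ _).zero_mem⟩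
  add_mem' := fun {a b} ha hb =>
    ⟨fun S hS => by simp [ha.1 S hS, hb.1 S hS], fun S => (ℳ _).add_mem (ha.2 S) (hb.2 S)⟩
  neg_mem' := fun {a} ha =>
    ⟨fun S hS => by simp [ha.1 S hS], fun S => (ℳ _).neg_mem (ha.2 S)⟩

/-- Cycles of homological degree `i` and internal degree `μ`. -/
noncomputable def cycles (ℳ : ℤ → AddSubgroup M) (i : ℕ) (μ : ℤ) :
    AddSubgroup (Finset (Fin n) → M) :=
  chains n ℳ i μ ⊓ (differential k n).ker

/-- Boundaries of homological degree `i` and internal degree `μ`. -/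
noncomputable def boundaries (ℳ : ℤ → AddSubgroup M) (i : ℕ) (μ : ℤ) :
    AddSubgroup (Finset (Fin n) → M) :=
  (chains n ℳ (i + 1) μ).map (differential k n)

theorem differential_differential (c : Finset (Fin n) → M) :
    differential k n (differential k n c) = 0 := by
  funext T
  simp only [differential, AddMonoidHom.coe_mk, ZeroHom.coe_mk, Pi.zero_apply, Finset.smul_sum]
  rw [Finset.sum_sigma']
  refine Finset.sum_involution (fun p _ => ⟨p.2, p.1⟩) ?_ ?_ ?_ ?_
  · rintro ⟨a, b⟩ h
    simp only [Finset.mem_sigma, Finset.mem_compl, Finset.mem_insert, not_or] at h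
    obtain ⟨ha, hab, hb⟩ := h
    simp only [Finset.insert_comm b a T, Finset.filter_insert, ← mul_smul]
    rw [← add_smul]
    convert zero_smul (MvPolynomial (Fin n) k) (c (insert a (insert b T))) using 2
    rcases lt_or_gt_of_ne hab with h1 | h1
    · rw [if_neg (not_lt.mpr h1.le), if_pos h1, Finset.card_insert_of_notMem (by simp [hb])]
      ring
    · rw [if_pos h1, if_neg (not_lt.mpr h1.le), Finset.card_insert_of_notMem (by simp [ha])]
      ring
  · rintro ⟨a, b⟩ h _ heq
    simp only [Finset.mem_sigma, Finset.mem_compl, Finset.mem_insert, not_or] at h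
    simp only [Sigma.mk.injEq] at heq
    exact h.2.1 heq.1
  · rintro ⟨a, b⟩ h
    simp only [Finset.mem_sigma, Finset.mem_compl, Finset.mem_insert, not_or] at h ⊢
    exact ⟨h.2.2, fun e => h.2.1 e.symm, h.1⟩
  · rintro ⟨a, b⟩ _
    rfl

theorem boundaries_le_cycles {ℳ : ℤ → AddSubgroup M} (hℳ : IsModuleGrading (k := k) (n := n) ℳ)
    (i : ℕ) (μ : ℤ) : boundaries k n ℳ i μ ≤ cycles k n ℳ i μ := by
  rintro _ ⟨c, hc, rfl⟩
  refine ⟨⟨fun S hS => ?_, fun S => ?_⟩, differential_differential k n c⟩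
  · refine Finset.sum_eq_zero fun j hj => ?_
    rw [hc.1 _ (by rw [Finset.card_insert_of_notMem (Finset.mem_compl.mp hj)]; omega)]
    simp
  · refine (ℳ _).sum_mem fun j _ => ?_
    have h1 : (X j : MvPolynomial (Fin n) k) • c (insert j S) ∈ ℳ (μ - i) := by
      have h2 := hℳ.smul_mem 1 _ _ _ (isHomogeneous_X k j) (hc.2 (insert j S))
      convert h2 using 2
      push_cast
      ring
    rcases neg_one_pow_eq_or (MvPolynomial (Fin n) k) (S.filter (· < j)).card with h | h
    · rw [h, one_smul]
      exact h1
    · rw [h, neg_smul, one_smul]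
      exact (ℳ _).neg_mem h1

/-- The graded piece `H_i(x₁, …, xₙ; M)_μ` of Koszul homology, that is,
`Tor_i(M, k)_μ` over `k[x₁, …, xₙ]`. -/
abbrev homology (ℳ : ℤ → AddSubgroup M) (i : ℕ) (μ : ℤ) : Type v :=
  cycles k n ℳ i μ ⧸ (boundaries k n ℳ i μ).addSubgroupOf (cycles k n ℳ i μ)

/-- `b_i(M) = max {μ | Tor_i(M, k)_μ ≠ 0}`, with `max ∅ = -∞`. -/
noncomputable def maxDegree (ℳ : ℤ → AddSubgroup M) (i : ℕ) : EReal :=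
  ⨆ (μ : ℤ) (_ : Nontrivial (homology k n ℳ i μ)), ((μ : ℝ) : EReal)

end Koszul

/-- The Castelnuovo-Mumford regularity `reg M = max_i {b_i(M) - i}`, which is `-∞` for `M = 0`. -/
noncomputable def castelnuovoMumfordReg (k : Type u) [Field k] (n : ℕ) {M : Type v}
    [AddCommGroup M] [Module (MvPolynomial (Fin n) k) M] (ℳ : ℤ → AddSubgroup M) : EReal :=
  ⨆ i : ℕ, (Koszul.maxDegree k n ℳ i - ((i : ℝ) : EReal))

/-! Write `H_i` for Koszul homology. A form `f` of degree `d > 0` acts as zero on `H_i(M)`, since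
wedging with `e_j` is a homotopy from `x_j` to `0`. With `K = 0 :_M f`, the sequences `0 → K → M →
M/K → 0` and `0 → (M/K)(-d) → M → M/fM → 0` then force `H_i(M)_μ = 0` as soon as `H_i(K)_μ` and
`H_{i+1}(M/fM)_{μ+d}` vanish (`Koszul.homologyVanishes_of_ker_of_coker`). The case `f = l`, `d = 1`
is the inequality.

Conversely, the same sequences bound `reg(M/lM)` by `reg M` and `reg K`
(`Koszul.homologyVanishes_coker`), so it remains to see that `reg K ≤ reg M`. As `H_{n+1} = 0`,
`H_n(K)` embeds in `H_n(M)`, while `H_{n-1}(K)` is controlled by `H_{n-1}(M)` and by `H_n(M/K)`,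
which embeds in `H_n(M)(1)`.

In dimension at most one, `H_n` and `H_{n-1}` determine the regularity
(`Koszul.homologyVanishes_of_ringKrullDim_le_one`). Prime avoidance gives a homogeneous parameter
`f`, of some degree `d`; its kernel and cokernel vanish in large degrees, so their top degrees are
seen by the socle, that is, by `H_n`. The criterion of the first paragraph, applied to this `f`,
concludes. -/

theorem Koszul.mem_chains {n : ℕ} {M : Type v} [AddCommGroup M] {ℳ : ℤ → AddSubgroup M} {i : ℕ}
    {μ : ℤ} {c : Finset (Fin n) → M} :
    c ∈ chains n ℳ i μ ↔ (∀ S, S.card ≠ i → c S = 0) ∧ ∀ S, c S ∈ ℳ (μ - i) :=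
  Iff.rfl

/-! ### Koszul homology and its annihilation by forms of positive degree -/

namespace Koszul

variable (k : Type u) [Field k] (n : ℕ)

section

variable {M : Type v} [AddCommGroup M] [Module (MvPolynomial (Fin n) k) M]

/-- Vanishing of `H_i(x₁, …, xₙ; M)_μ`: every cycle is a boundary. -/
def HomologyVanishes (ℳ : ℤ → AddSubgroup M) (i : ℕ) (μ : ℤ) : Prop :=
  ∀ c ∈ chains n ℳ i μ, differential k n c = 0 → ∃ b ∈ chains n ℳ (i + 1) μ, differential k n b = c

theorem nontrivial_homology_iff (ℳ : ℤ → AddSubgroup M) (i : ℕ) (μ : ℤ) :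
    Nontrivial (homology k n ℳ i μ) ↔ ¬ HomologyVanishes k n ℳ i μ := by
  rw [← not_subsingleton_iff_nontrivial, not_iff_not, QuotientAddGroup.subsingleton_iff,
    AddSubgroup.addSubgroupOf_eq_top]
  exact ⟨fun h c hc hd => h ⟨hc, hd⟩, fun h c hc => h c hc.1 hc.2⟩

theorem differential_apply (c : Finset (Fin n) → M) (T : Finset (Fin n)) :
    differential k n c T = ∑ j ∈ Tᶜ, (-1 : MvPolynomial (Fin n) k) ^ (T.filter (· < j)).card •
      (X j : MvPolynomial (Fin n) k) • c (insert j T) :=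
  rfl

theorem differential_comp {M' : Type v} [AddCommGroup M'] [Module (MvPolynomial (Fin n) k) M']
    (φ : M →ₗ[MvPolynomial (Fin n) k] M') (c : Finset (Fin n) → M) :
    differential k n (φ ∘ c) = φ ∘ differential k n c := by
  funext T
  simp [differential_apply]

theorem differential_smul (p : MvPolynomial (Fin n) k) (c : Finset (Fin n) → M) :
    differential k n (p • c) = p • differential k n c :=
  differential_comp k n (LinearMap.lsmul _ M p) c

variable {k n}

theorem differential_mem_chains {ℳ : ℤ → AddSubgroup M}
    (hℳ : IsModuleGrading (k := k) (n := n) ℳ) {i : ℕ} {μ : ℤ} {c : Finset (Fin n) → M}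
    (hc : c ∈ chains n ℳ (i + 1) μ) : differential k n c ∈ chains n ℳ i μ :=
  (boundaries_le_cycles k n hℳ i μ ⟨c, hc, rfl⟩).1

theorem differential_eq_zero_of_mem_chains_zero {ℳ : ℤ → AddSubgroup M} {μ : ℤ}
    {c : Finset (Fin n) → M} (hc : c ∈ chains n ℳ 0 μ) : differential k n c = 0 := by
  funext T
  rw [differential_apply]
  refine Finset.sum_eq_zero fun j _ => ?_
  rw [hc.1 _ (by simp)]
  simp

theorem chains_eq_zero {ℳ : ℤ → AddSubgroup M} {i : ℕ} {μ : ℤ} {c : Finset (Fin n) → M}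
    (hc : c ∈ chains n ℳ i μ) (hi : n < i) : c = 0 := by
  funext S
  refine hc.1 S fun h => ?_
  have := Finset.card_le_univ S
  simp at this
  omega

theorem homologyVanishes_of_lt {ℳ : ℤ → AddSubgroup M} {i : ℕ} (μ : ℤ) (hi : n < i) :
    HomologyVanishes k n ℳ i μ := fun c hc _ =>
  ⟨0, zero_mem _, by rw [chains_eq_zero hc hi, map_zero]⟩

theorem homologyVanishes_of_eq_bot {ℳ : ℤ → AddSubgroup M} {i : ℕ} {μ : ℤ}
    (h : ℳ (μ - i) = ⊥) : HomologyVanishes k n ℳ i μ := fun c hc _ =>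
  ⟨0, zero_mem _, by
    rw [map_zero]
    funext S
    exact (AddSubgroup.mem_bot.1 (h ▸ hc.2 S)).symm⟩

theorem smul_mem_chains {ℳ : ℤ → AddSubgroup M}
    (hℳ : IsModuleGrading (k := k) (n := n) ℳ) {i d : ℕ} {μ : ℤ} {c : Finset (Fin n) → M}
    {p : MvPolynomial (Fin n) k} (hp : p.IsHomogeneous d)
    (hc : c ∈ chains n ℳ i μ) : p • c ∈ chains n ℳ i (μ + d) := by
  refine ⟨fun S hS => by simp [hc.1 S hS], fun S => ?_⟩
  have := hℳ.smul_mem d _ p _ hp (hc.2 S)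
  rwa [show μ - i + (d : ℤ) = μ + d - i by ring] at this

/-- Exterior multiplication by the basis element `e_j`. -/
noncomputable def wedge (k : Type u) [Field k] [Module (MvPolynomial (Fin n) k) M] (j : Fin n)
    (c : Finset (Fin n) → M) (S : Finset (Fin n)) : M :=
  if j ∈ S then (-1 : MvPolynomial (Fin n) k) ^ ((S.erase j).filter (· < j)).card • c (S.erase j)
  else 0

theorem wedge_mem_chains (ℳ : ℤ → AddSubgroup M) (j : Fin n) {i : ℕ} {μ : ℤ}
    {c : Finset (Fin n) → M} (hc : c ∈ chains n ℳ i μ) :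
    wedge k j c ∈ chains n ℳ (i + 1) (μ + 1) := by
  refine ⟨fun S hS => ?_, fun S => ?_⟩
  · unfold wedge
    split_ifs with h
    · have := Finset.card_erase_add_one h
      rw [hc.1 _ fun h1 => hS (by rw [← this, h1]), smul_zero]
    · rfl
  · unfold wedge
    split_ifs with h
    · have h1 := hc.2 (S.erase j)
      rw [show μ + 1 - ((i + 1 : ℕ) : ℤ) = μ - i by push_cast; ring]
      rcases neg_one_pow_eq_or (MvPolynomial (Fin n) k) ((S.erase j).filter (· < j)).card with h | h
      · rwa [h, one_smul]
      · rw [h, neg_smul, one_smul]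
        exact (ℳ _).neg_mem h1
    · exact zero_mem _

/-- Exterior multiplication by `e_j` is a homotopy between multiplication by `x_j` and `0`. -/
theorem differential_wedge_add (j : Fin n) (c : Finset (Fin n) → M) :
    differential k n (wedge k j c) + wedge k j (differential k n c) =
      (X j : MvPolynomial (Fin n) k) • c := by
  funext T
  rw [Pi.add_apply, Pi.smul_apply, differential_apply]
  by_cases hj : j ∈ T
  · have hcompl : (T.erase j)ᶜ = insert j Tᶜ := Finset.compl_erase
    rw [wedge, if_pos hj, differential_apply, hcompl, Finset.sum_insert (by simp [hj]), smul_add,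
      Finset.insert_erase hj, add_left_comm, Finset.smul_sum, ← Finset.sum_add_distrib,
      Finset.sum_eq_zero, add_zero, ← mul_smul, ← mul_pow, neg_one_mul, neg_neg, one_pow, one_smul]
    intro a ha
    have haT : a ∉ T := Finset.mem_compl.1 ha
    have haj : a ≠ j := fun h => haT (h ▸ hj)
    rw [wedge, if_pos (Finset.mem_insert_of_mem hj), Finset.erase_insert_of_ne haj]
    simp only [← mul_smul]
    rw [← add_smul]
    convert zero_smul (MvPolynomial (Fin n) k) (c (insert a (T.erase j))) using 2
    have h1 : (insert a (T.erase j)).filter (· < j) =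
        if a < j then insert a ((T.erase j).filter (· < j)) else (T.erase j).filter (· < j) :=
      Finset.filter_insert ..
    have h2 : T.filter (· < a) = if j < a then insert j ((T.erase j).filter (· < a))
        else (T.erase j).filter (· < a) := by
      conv_lhs => rw [← Finset.insert_erase hj]
      exact Finset.filter_insert ..
    rcases lt_or_gt_of_ne haj with h | h
    · rw [h1, h2, if_pos h, if_neg (not_lt.2 h.le), Finset.card_insert_of_notMem (by simp [haT])]
      ring
    · rw [h1, h2, if_pos h, if_neg (not_lt.2 h.le), Finset.card_insert_of_notMem (by simp)]
      ring
  · rw [wedge, if_neg hj, add_zero, Finset.sum_eq_single_of_mem j (by simpa using hj)]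
    · rw [wedge, if_pos (Finset.mem_insert_self _ _), Finset.erase_insert hj, smul_comm (X j : MvPolynomial (Fin n) k), smul_smul,
        ← mul_pow, neg_one_mul, neg_neg, one_pow, one_smul]
    · intro a ha haj
      rw [wedge, if_neg (by simp [hj, haj.symm]), smul_zero, smul_zero]

/-- Forms of positive degree annihilate Koszul homology. -/
theorem exists_differential_eq_smul {ℳ : ℤ → AddSubgroup M}
    (hℳ : IsModuleGrading (k := k) (n := n) ℳ) {i d : ℕ} {μ : ℤ} {c : Finset (Fin n) → M}
    {p : MvPolynomial (Fin n) k} (hp : p.IsHomogeneous d) (hd : d ≠ 0)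
    (hc : c ∈ chains n ℳ i μ) (hdc : differential k n c = 0) :
    ∃ b ∈ chains n ℳ (i + 1) (μ + d), differential k n b = p • c := by
  suffices h : p • c ∈ (chains n ℳ (i + 1) (μ + d)).map (differential k n) from h
  rw [p.as_sum, Finset.sum_smul]
  refine sum_mem fun s hs => ?_
  have hdeg : s.degree = d := by
    rw [Finsupp.degree_eq_weight_one]; exact hp (mem_support_iff.1 hs)
  obtain ⟨j, hj⟩ : ∃ j, s j ≠ 0 := by
    by_contra! h
    exact hd (by rw [← hdeg, show s = 0 from Finsupp.ext h, map_zero])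
  -- Each monomial of `p` contains some `x_j`; the homotopy for `x_j` is applied to the cycle
  -- multiplied by the remaining factor.
  obtain ⟨t, rfl⟩ : ∃ t, s = Finsupp.single j 1 + t :=
    ⟨s - Finsupp.single j 1, (add_tsub_cancel_of_le
      (Finsupp.single_le_iff.2 (Nat.one_le_iff_ne_zero.2 hj))).symm⟩
  have ht : (monomial t (coeff (Finsupp.single j 1 + t) p)).IsHomogeneous (d - 1) := by
    apply isHomogeneous_monomial
    rw [map_add, Finsupp.degree_single] at hdeg
    omega
  have h1 := smul_mem_chains hℳ ht hc
  refine ⟨wedge k j (monomial t (coeff (Finsupp.single j 1 + t) p) • c), ?_, ?_⟩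
  · have := wedge_mem_chains (k := k) ℳ j h1
    rwa [show μ + ((d - 1 : ℕ) : ℤ) + 1 = μ + d by omega] at this
  · have := differential_wedge_add (k := k) j (monomial t (coeff (Finsupp.single j 1 + t) p) • c)
    rw [differential_smul, hdc, smul_zero] at this
    have h0 : wedge k j (0 : Finset (Fin n) → M) = 0 := by
      funext S
      simp [wedge]
    rw [h0, add_zero] at this
    rw [this, smul_smul, X, monomial_mul, one_mul]

end

/-! ### The long exact homology sequence, in terms of vanishing -/

/-- A short exact sequence `0 → M' → M → M'' → 0` of graded modules, with maps of degree `0`. -/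
structure IsGradedExact {k : Type u} [Field k] {n : ℕ} {M' M M'' : Type v} [AddCommGroup M']
    [AddCommGroup M] [AddCommGroup M''] [Module (MvPolynomial (Fin n) k) M']
    [Module (MvPolynomial (Fin n) k) M] [Module (MvPolynomial (Fin n) k) M'']
    (φ : M' →ₗ[MvPolynomial (Fin n) k] M) (ψ : M →ₗ[MvPolynomial (Fin n) k] M'')
    (ℳ' : ℤ → AddSubgroup M') (ℳ : ℤ → AddSubgroup M) (ℳ'' : ℤ → AddSubgroup M'') : Prop where
  injective : Function.Injective φ
  exact : Function.Exact φ ψ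
  mem_iff : ∀ i m, φ m ∈ ℳ i ↔ m ∈ ℳ' i
  map_mem : ∀ i, ∀ m ∈ ℳ i, ψ m ∈ ℳ'' i
  exists_lift : ∀ i, ∀ x ∈ ℳ'' i, ∃ m ∈ ℳ i, ψ m = x

namespace IsGradedExact

variable {k n}
variable {M' M M'' : Type v} [AddCommGroup M']
    [AddCommGroup M] [AddCommGroup M''] [Module (MvPolynomial (Fin n) k) M']
    [Module (MvPolynomial (Fin n) k) M] [Module (MvPolynomial (Fin n) k) M'']
    {φ : M' →ₗ[MvPolynomial (Fin n) k] M} {ψ : M →ₗ[MvPolynomial (Fin n) k] M''}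
    {ℳ' : ℤ → AddSubgroup M'} {ℳ : ℤ → AddSubgroup M} {ℳ'' : ℤ → AddSubgroup M''}
    {i : ℕ} {μ : ℤ}

theorem comp_left_mem_chains (h : IsGradedExact φ ψ ℳ' ℳ ℳ'') {c : Finset (Fin n) → M'}
    (hc : c ∈ chains n ℳ' i μ) : φ ∘ c ∈ chains n ℳ i μ :=
  ⟨fun S hS => by simp [hc.1 S hS], fun S => (h.mem_iff _ _).2 (hc.2 S)⟩

theorem comp_right_mem_chains (h : IsGradedExact φ ψ ℳ' ℳ ℳ'') {c : Finset (Fin n) → M}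
    (hc : c ∈ chains n ℳ i μ) : ψ ∘ c ∈ chains n ℳ'' i μ :=
  ⟨fun S hS => by simp [hc.1 S hS], fun S => h.map_mem _ _ (hc.2 S)⟩

theorem exists_comp_right_eq (h : IsGradedExact φ ψ ℳ' ℳ ℳ'') {c : Finset (Fin n) → M''}
    (hc : c ∈ chains n ℳ'' i μ) : ∃ b ∈ chains n ℳ i μ, ψ ∘ b = c := by
  choose b hb hbc using fun S => h.exists_lift _ _ (hc.2 S)
  -- A chosen lift of a zero coefficient may be nonzero, so the lifts are cut off outside `#S = i`.
  refine ⟨fun S => if S.card = i then b S else 0, ⟨fun S hS => if_neg hS, fun S => ?_⟩, ?_⟩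
  · dsimp only
    split_ifs
    exacts [hb S, zero_mem _]
  · funext S
    by_cases hS : S.card = i
    · simp [hS, hbc]
    · simp [hS, hc.1 S hS]

theorem exists_comp_left_eq (h : IsGradedExact φ ψ ℳ' ℳ ℳ'') {c : Finset (Fin n) → M}
    (hc : c ∈ chains n ℳ i μ) (h0 : ψ ∘ c = 0) : ∃ b ∈ chains n ℳ' i μ, φ ∘ b = c := by
  choose b hb using fun S => (h.exact (c S)).1 (congrFun h0 S)
  refine ⟨b, ⟨fun S hS => h.injective ?_, fun S => (h.mem_iff _ _).1 ?_⟩, funext hb⟩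
  · rw [hb, hc.1 S hS, map_zero]
  · rw [hb]
    exact hc.2 S

theorem comp_comp (h : IsGradedExact φ ψ ℳ' ℳ ℳ'') (c : Finset (Fin n) → M') :
    ψ ∘ φ ∘ c = 0 :=
  funext fun S => h.exact.apply_apply_eq_zero (c S)

theorem comp_left_injective (h : IsGradedExact φ ψ ℳ' ℳ ℳ'') :
    Function.Injective fun c : Finset (Fin n) → M' => φ ∘ c :=
  h.injective.comp_left

/-- Exactness of the long homology sequence at `H_i(M')`: a cycle that bounds in `M` bounds if
`H_{i+1}(M'')` vanishes. -/
theorem exists_differential_eq (h : IsGradedExact φ ψ ℳ' ℳ ℳ'')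
    (hℳ : IsModuleGrading (k := k) (n := n) ℳ) (hv : HomologyVanishes k n ℳ'' (i + 1) μ)
    {c : Finset (Fin n) → M'} {b : Finset (Fin n) → M}
    (hb : b ∈ chains n ℳ (i + 1) μ) (hbc : differential k n b = φ ∘ c) :
    ∃ b' ∈ chains n ℳ' (i + 1) μ, differential k n b' = c := by
  obtain ⟨e', he', hde⟩ := hv (ψ ∘ b) (h.comp_right_mem_chains hb) (by
    rw [differential_comp, hbc, h.comp_comp])
  obtain ⟨e, he, rfl⟩ := h.exists_comp_right_eq he'
  obtain ⟨b', hb', hbe⟩ := h.exists_comp_left_eq (sub_mem hb (differential_mem_chains hℳ he)) (by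
    rw [differential_comp] at hde
    funext S
    have := congrFun hde S
    simp only [Function.comp_apply] at this
    simp [this])
  refine ⟨b', hb', h.comp_left_injective ?_⟩
  dsimp only
  rw [← differential_comp, hbe, map_sub, differential_differential, sub_zero, hbc]

theorem homologyVanishes_left (h : IsGradedExact φ ψ ℳ' ℳ ℳ'')
    (hℳ : IsModuleGrading (k := k) (n := n) ℳ) (hv : HomologyVanishes k n ℳ'' (i + 1) μ)
    (hM : HomologyVanishes k n ℳ i μ) : HomologyVanishes k n ℳ' i μ := fun c hc hdc => by
  obtain ⟨b, hb, hbc⟩ := hM (φ ∘ c) (h.comp_left_mem_chains hc) (by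
    rw [differential_comp, hdc]
    funext S
    simp)
  exact h.exists_differential_eq hℳ hv hb hbc

/-- Exactness of `H_i(M) → H_i(M'') → H_{i-1}(M')`. Quantifying over `j + 1 = i` leaves no condition
when `i = 0`. -/
theorem homologyVanishes_right (h : IsGradedExact φ ψ ℳ' ℳ ℳ'')
    (hℳ : IsModuleGrading (k := k) (n := n) ℳ) (hM : HomologyVanishes k n ℳ i μ)
    (hv : ∀ j, j + 1 = i → HomologyVanishes k n ℳ' j μ) : HomologyVanishes k n ℳ'' i μ := by
  intro c' hc' hdc
  obtain ⟨c, hc, rfl⟩ := h.exists_comp_right_eq hc'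
  -- A lift `c` of a cycle need not be a cycle; its differential is a cycle of `M'`, and bounding it
  -- there corrects `c`.
  have key : ∃ b ∈ chains n ℳ' i μ, differential k n (φ ∘ b) = differential k n c := by
    rcases i with _ | i
    · exact ⟨0, zero_mem _, by
        rw [differential_eq_zero_of_mem_chains_zero hc, differential_comp, map_zero]
        funext S
        simp⟩
    · rw [differential_comp] at hdc
      obtain ⟨z, hz, hzc⟩ := h.exists_comp_left_eq (differential_mem_chains hℳ hc) hdc
      obtain ⟨b, hb, hbz⟩ := hv i rfl z hz (h.comp_left_injective (by
        dsimp only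
        rw [← differential_comp, hzc, differential_differential]
        funext S
        simp))
      exact ⟨b, hb, by rw [differential_comp, hbz, hzc]⟩
  obtain ⟨b, hb, hbc⟩ := key
  obtain ⟨e, he, hec⟩ := hM (c - φ ∘ b) (sub_mem hc (h.comp_left_mem_chains hb)) (by
    rw [map_sub, hbc, sub_self])
  refine ⟨ψ ∘ e, h.comp_right_mem_chains he, ?_⟩
  rw [differential_comp, hec]
  funext S
  simp [h.exact.apply_apply_eq_zero]

end IsGradedExact

end Koszul

/-! ### Gradings described by their projections -/

namespace DirectSum.IsInternal

variable {M : Type v} [AddCommGroup M] {ℳ : ℤ → AddSubgroup M}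

/-- The projection onto the component of degree `i`. -/
noncomputable def component (h : DirectSum.IsInternal ℳ) (i : ℤ) : M →+ M :=
  letI := h.chooseDecomposition
  (ℳ i).subtype.comp ((DFinsupp.evalAddMonoidHom i).comp
    (DirectSum.decomposeAddEquiv ℳ).toAddMonoidHom)

variable (h : DirectSum.IsInternal ℳ)
include h

theorem component_mem (i : ℤ) (m : M) : h.component i m ∈ ℳ i :=
  SetLike.coe_mem _

theorem component_of_mem {i : ℤ} {m : M} (hm : m ∈ ℳ i) : h.component i m = m :=
  let := h.chooseDecomposition
  DirectSum.decompose_of_mem_same ℳ hm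

theorem component_of_mem_ne {i j : ℤ} {m : M} (hm : m ∈ ℳ i) (hij : i ≠ j) :
    h.component j m = 0 :=
  let := h.chooseDecomposition
  DirectSum.decompose_of_mem_ne ℳ hm hij

theorem exists_sum_component (m : M) : ∃ s : Finset ℤ, ∑ i ∈ s, h.component i m = m := by
  classical
  let := h.chooseDecomposition
  exact ⟨_, DirectSum.sum_support_decompose ℳ m⟩

theorem induction_on {p : M → Prop} (m : M) (zero : p 0)
    (mem : ∀ i, ∀ x ∈ ℳ i, p x) (add : ∀ x y, p x → p y → p (x + y)) : p m := by
  obtain ⟨s, hs⟩ := h.exists_sum_component m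
  rw [← hs]
  exact Finset.sum_induction _ p add zero fun i _ => mem i _ (h.component_mem i m)

omit h in
theorem of_projections (π : ℤ → M →+ M) (mem : ∀ i m, π i m ∈ ℳ i)
    (of_mem : ∀ i, ∀ m ∈ ℳ i, π i m = m) (of_mem_ne : ∀ i j, i ≠ j → ∀ m ∈ ℳ i, π j m = 0)
    (exists_sum : ∀ m, ∃ s : Finset ℤ, ∑ i ∈ s, π i m = m) : DirectSum.IsInternal ℳ := by
  constructor
  · rw [injective_iff_map_eq_zero]
    intro x hx
    have key : ∀ j, (π j).comp (DirectSum.coeAddMonoidHom ℳ) =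
        (ℳ j).subtype.comp (DFinsupp.evalAddMonoidHom j) := by
      intro j
      refine DirectSum.addHom_ext fun i y => ?_
      change π j (DirectSum.coeAddMonoidHom ℳ (DirectSum.of _ i y)) =
        (DirectSum.of (fun i => ℳ i) i y j : M)
      rw [DirectSum.coeAddMonoidHom_of]
      by_cases hij : i = j
      · subst hij
        rw [DirectSum.of_eq_same, of_mem i y y.2]
      · rw [DirectSum.of_eq_of_ne _ _ _ (Ne.symm hij), of_mem_ne i j hij y y.2, ZeroMemClass.coe_zero]
    ext j
    have := DFunLike.congr_fun (key j) x
    simp only [AddMonoidHom.comp_apply, hx, map_zero] at this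
    exact this.symm
  · intro m
    obtain ⟨s, hs⟩ := exists_sum m
    refine ⟨∑ i ∈ s, DirectSum.of (fun i => ℳ i) i ⟨π i m, mem i m⟩, ?_⟩
    simp [map_sum, hs]

end DirectSum.IsInternal

namespace IsModuleGrading

variable {k : Type u} [Field k] {n : ℕ} {M : Type v} [AddCommGroup M]
  [Module (MvPolynomial (Fin n) k) M] {ℳ : ℤ → AddSubgroup M}

/-- The projection onto the component of degree `i`. -/
noncomputable abbrev component (hℳ : IsModuleGrading (k := k) (n := n) ℳ) (i : ℤ) : M →+ M :=
  hℳ.isInternal.component i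

theorem component_smul (hℳ : IsModuleGrading (k := k) (n := n) ℳ) {d : ℕ}
    {p : MvPolynomial (Fin n) k} (hp : p.IsHomogeneous d) (i : ℤ) (m : M) :
    hℳ.component (i + d) (p • m) = p • hℳ.component i m := by
  refine hℳ.isInternal.induction_on (p := fun m => hℳ.component (i + d) (p • m) =
    p • hℳ.component i m) m (by simp) (fun j x hx => ?_) (fun x y hx hy => ?_)
  · have hpx := hℳ.smul_mem d j p x hp hx
    by_cases hij : j = i
    · subst hij
      rw [hℳ.isInternal.component_of_mem hpx, hℳ.isInternal.component_of_mem hx]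
    · rw [hℳ.isInternal.component_of_mem_ne hpx (by omega),
        hℳ.isInternal.component_of_mem_ne hx hij, smul_zero]
  · simp only [smul_add, map_add, hx, hy]

theorem inducedGrading (hℳ : IsModuleGrading (k := k) (n := n) ℳ)
    (N : Submodule (MvPolynomial (Fin n) k) M) (hN : ∀ i, ∀ m ∈ N, hℳ.component i m ∈ N) :
    IsModuleGrading (k := k) (n := n) (N.inducedGrading ℳ) where
  isInternal := by
    refine .of_projections (fun i => ((hℳ.component i).comp N.subtype.toAddMonoidHom).codRestrict
      N.toAddSubgroup fun m => hN i m m.2) (fun i m => hℳ.isInternal.component_mem i (m : M))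
      (fun i m hm => Subtype.ext (hℳ.isInternal.component_of_mem hm))
      (fun i j hij m hm => Subtype.ext (hℳ.isInternal.component_of_mem_ne hm hij)) fun m => ?_
    obtain ⟨s, hs⟩ := hℳ.isInternal.exists_sum_component (m : M)
    refine ⟨s, Subtype.ext ?_⟩
    conv_rhs => rw [← hs]
    exact AddSubmonoidClass.coe_finsetSum _ _
  smul_mem d i p m hp hm := hℳ.smul_mem d i p m hp hm

theorem quotientGrading (hℳ : IsModuleGrading (k := k) (n := n) ℳ)
    (N : Submodule (MvPolynomial (Fin n) k) M) (hN : ∀ i, ∀ m ∈ N, hℳ.component i m ∈ N) :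
    IsModuleGrading (k := k) (n := n) (N.quotientGrading ℳ) where
  isInternal := by
    refine .of_projections (fun i => QuotientAddGroup.map N.toAddSubgroup N.toAddSubgroup
      (hℳ.component i) (hN i)) (fun i m => ?_) ?_ ?_ fun m => ?_
    · obtain ⟨m, rfl⟩ := N.mkQ_surjective m
      exact ⟨_, hℳ.isInternal.component_mem i m, rfl⟩
    · rintro i _ ⟨m, hm, rfl⟩
      exact congrArg N.mkQ (hℳ.isInternal.component_of_mem hm)
    · rintro i j hij _ ⟨m, hm, rfl⟩
      exact (congrArg N.mkQ (hℳ.isInternal.component_of_mem_ne hm hij)).trans (map_zero _)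
    · obtain ⟨m, rfl⟩ := N.mkQ_surjective m
      obtain ⟨s, hs⟩ := hℳ.isInternal.exists_sum_component m
      refine ⟨s, ?_⟩
      conv_rhs => rw [← hs, map_sum]
      rfl
  smul_mem d i p m hp hm := by
    obtain ⟨m, hm, rfl⟩ := hm
    exact ⟨p • m, hℳ.smul_mem d i p m hp hm, map_smul N.mkQ p m⟩

theorem component_mem_of_mem_iff_smul_eq_zero (hℳ : IsModuleGrading (k := k) (n := n) ℳ) {d : ℕ}
    {f : MvPolynomial (Fin n) k} (hf : f.IsHomogeneous d)
    {K : Submodule (MvPolynomial (Fin n) k) M} (hK : ∀ m, m ∈ K ↔ f • m = 0) (i : ℤ) (m : M)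
    (hm : m ∈ K) : hℳ.component i m ∈ K := by
  rw [hK] at hm ⊢
  rw [← hℳ.component_smul hf, hm, map_zero]

theorem component_mem_of_mem_iff_exists_smul (hℳ : IsModuleGrading (k := k) (n := n) ℳ) {d : ℕ}
    {f : MvPolynomial (Fin n) k} (hf : f.IsHomogeneous d)
    {N : Submodule (MvPolynomial (Fin n) k) M} (hN : ∀ m, m ∈ N ↔ ∃ x, f • x = m) (i : ℤ) (m : M)
    (hm : m ∈ N) : hℳ.component i m ∈ N := by
  rw [hN] at hm ⊢
  obtain ⟨x, rfl⟩ := hm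
  exact ⟨hℳ.component (i - d) x, by rw [← hℳ.component_smul hf, sub_add_cancel]⟩

/-- For `x` of degree `j`, the component of `p • x` in degree `j + d` is the degree-`d` component of
`p` times `x`. -/
theorem annihilator_homogeneousComponent (hℳ : IsModuleGrading (k := k) (n := n) ℳ)
    {p : MvPolynomial (Fin n) k} (hp : p ∈ Module.annihilator (MvPolynomial (Fin n) k) M) (d : ℕ) :
    homogeneousComponent d p ∈ Module.annihilator (MvPolynomial (Fin n) k) M := by
  rw [Module.mem_annihilator] at hp ⊢
  intro m
  refine hℳ.isInternal.induction_on (p := fun m => homogeneousComponent d p • m = 0) m (by simp)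
    (fun j x hx => ?_) (fun x y hx hy => by simp only [smul_add, hx, hy, add_zero])
  have h1 : hℳ.component (j + d) (p • x) = homogeneousComponent d p • x := by
    have hmem := fun e => hℳ.smul_mem e j _ x (homogeneousComponent_isHomogeneous e p) hx
    by_cases hd : d ∈ Finset.range (p.totalDegree + 1)
    · conv_lhs => rw [← sum_homogeneousComponent p, Finset.sum_smul, map_sum]
      rw [Finset.sum_eq_single_of_mem d hd, hℳ.isInternal.component_of_mem (hmem d)]
      intro e _ hed
      exact hℳ.isInternal.component_of_mem_ne (hmem e) (by simpa using hed)
    · conv_lhs => rw [← sum_homogeneousComponent p, Finset.sum_smul, map_sum]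
      rw [homogeneousComponent_eq_zero _ _ (by simpa using hd), zero_smul]
      refine Finset.sum_eq_zero fun e he => hℳ.isInternal.component_of_mem_ne (hmem e) ?_
      rintro h
      exact hd ((show e = d by simpa using h) ▸ he)
  rw [← h1, hp, map_zero]

end IsModuleGrading

/-! ### Koszul homology of the kernel and cokernel of a form -/

namespace Koszul

variable {k : Type u} [Field k] {n : ℕ} {M : Type v} [AddCommGroup M]
  [Module (MvPolynomial (Fin n) k) M] {ℳ : ℤ → AddSubgroup M} {i : ℕ} {μ : ℤ}

theorem isGradedExact_submodule (N : Submodule (MvPolynomial (Fin n) k) M)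
    (ℳ : ℤ → AddSubgroup M) :
    IsGradedExact N.subtype N.mkQ (N.inducedGrading ℳ) ℳ (N.quotientGrading ℳ) where
  injective := N.injective_subtype
  exact := LinearMap.exact_subtype_mkQ N
  mem_iff _ _ := Iff.rfl
  map_mem _ m hm := ⟨m, hm, rfl⟩
  exists_lift _ _ hx := hx

/-- The sequence `0 → (M/K)(-d) → M → M/fM → 0`, where `f` is a form of degree `d` and
`K = 0 :_M f`. -/
theorem exists_isGradedExact_smul (hℳ : IsModuleGrading (k := k) (n := n) ℳ) {d : ℕ}
    {f : MvPolynomial (Fin n) k} (hf : f.IsHomogeneous d)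
    {K N : Submodule (MvPolynomial (Fin n) k) M} (hK : ∀ m, m ∈ K ↔ f • m = 0)
    (hN : ∀ m, m ∈ N ↔ ∃ x, f • x = m) :
    ∃ φ : (M ⧸ K) →ₗ[MvPolynomial (Fin n) k] M, (∀ m, φ (K.mkQ m) = f • m) ∧
      IsGradedExact φ N.mkQ (fun i => K.quotientGrading ℳ (i - d)) ℳ (N.quotientGrading ℳ) := by
  refine ⟨K.liftQ (LinearMap.lsmul _ M f) fun m hm => (hK m).1 hm, fun m => rfl, ?_, ?_, ?_, ?_,
    fun _ _ hx => hx⟩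
  · rw [injective_iff_map_eq_zero]
    intro x hx
    obtain ⟨m, rfl⟩ := K.mkQ_surjective x
    exact (Submodule.Quotient.mk_eq_zero K).2 ((hK m).2 hx)
  · intro m
    rw [Submodule.mkQ_apply, Submodule.Quotient.mk_eq_zero, hN]
    exact ⟨fun ⟨x, hx⟩ => ⟨K.mkQ x, hx⟩, fun ⟨x, hx⟩ => by
      obtain ⟨x, rfl⟩ := K.mkQ_surjective x
      exact ⟨x, hx⟩⟩
  · intro i x
    obtain ⟨m, rfl⟩ := K.mkQ_surjective x
    change f • m ∈ ℳ i ↔ _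
    constructor
    · intro h
      refine ⟨hℳ.component (i - d) m, hℳ.isInternal.component_mem _ _, ?_⟩
      refine (Submodule.Quotient.eq K).2 ((hK _).2 ?_)
      rw [smul_sub, ← hℳ.component_smul hf, sub_add_cancel, hℳ.isInternal.component_of_mem h,
        sub_self]
    · rintro ⟨m', hm', h⟩
      have h1 := (hK _).1 ((Submodule.Quotient.eq K).1 h)
      rw [smul_sub, sub_eq_zero] at h1
      rw [← h1]
      simpa using hℳ.smul_mem d _ f m' hf hm'
  · exact fun _ m hm => ⟨m, hm, rfl⟩

theorem homologyVanishes_shift (d : ℤ) :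
    HomologyVanishes k n (fun i => ℳ (i - d)) i μ ↔ HomologyVanishes k n ℳ i (μ - d) := by
  have h : ∀ i, chains n (fun i => ℳ (i - d)) i μ = chains n ℳ i (μ - d) := fun i => by
    ext c
    simp only [mem_chains, sub_right_comm]
  unfold HomologyVanishes
  rw [h, h]

section smul

variable (hℳ : IsModuleGrading (k := k) (n := n) ℳ) {d : ℕ}
    {f : MvPolynomial (Fin n) k} (hf : f.IsHomogeneous d)
    {K N : Submodule (MvPolynomial (Fin n) k) M} (hK : ∀ m, m ∈ K ↔ f • m = 0)
    (hN : ∀ m, m ∈ N ↔ ∃ x, f • x = m)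
include hℳ hf hK hN

/-- For a cycle `c`, `f • c` is a boundary in `M`. Hence the class of `c` in `H_i(M/K)` dies in
`H_i(M)` under multiplication by `f`, and so is zero when `H_{i+1}(M/fM)` vanishes in the shifted
degree. Lifting a bounding chain to `M` moves `c`, modulo boundaries, into `K`. -/
theorem homologyVanishes_of_ker_of_coker (hd : d ≠ 0)
    (h1 : HomologyVanishes k n (K.inducedGrading ℳ) i μ)
    (h2 : HomologyVanishes k n (N.quotientGrading ℳ) (i + 1) (μ + d)) :
    HomologyVanishes k n ℳ i μ := by
  intro c hc hdc
  obtain ⟨φ, hφ, hS⟩ := exists_isGradedExact_smul hℳ hf hK hN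
  have hT := isGradedExact_submodule K ℳ
  obtain ⟨b, hb, hbc⟩ := exists_differential_eq_smul hℳ hf hd hc hdc
  obtain ⟨e', he₁, hec⟩ := hS.exists_differential_eq hℳ h2 (c := K.mkQ ∘ c) hb (by
    rw [hbc]
    exact funext fun S => (hφ (c S)).symm)
  have he' : e' ∈ chains n (K.quotientGrading ℳ) (i + 1) μ := by
    rw [mem_chains] at he₁ ⊢
    refine ⟨he₁.1, fun S => ?_⟩
    have := he₁.2 S
    rwa [show μ + d - ((i + 1 : ℕ) : ℤ) - d = μ - (i + 1 : ℕ) by ring] at this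
  obtain ⟨e, he, rfl⟩ := hT.exists_comp_right_eq he'
  obtain ⟨c', hc', hcc⟩ := hT.exists_comp_left_eq (sub_mem hc (differential_mem_chains hℳ he)) (by
    rw [differential_comp] at hec
    funext S
    have := congrFun hec S
    simp only [Function.comp_apply] at this
    simp [-Submodule.mkQ_apply, this])
  obtain ⟨b', hb', hbc'⟩ := h1 c' hc' (hT.comp_left_injective (by
    dsimp only
    rw [← differential_comp, hcc, map_sub, differential_differential, hdc]
    funext S
    simp))
  refine ⟨e + K.subtype ∘ b', add_mem he (hT.comp_left_mem_chains hb'), ?_⟩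
  rw [map_add, differential_comp, hbc', hcc, add_sub_cancel]

/-- Two connecting maps: `H_i(M/fM)` to `H_{i-1}(M/K)(-d)`, then `H_{i-1}(M/K)` to `H_{i-2}(K)`. -/
theorem homologyVanishes_coker (h1 : HomologyVanishes k n ℳ i μ)
    (h2 : ∀ j, j + 1 = i → HomologyVanishes k n ℳ j (μ - d))
    (h3 : ∀ j, j + 2 = i → HomologyVanishes k n (K.inducedGrading ℳ) j (μ - d)) :
    HomologyVanishes k n (N.quotientGrading ℳ) i μ := by
  obtain ⟨φ, -, hS⟩ := exists_isGradedExact_smul hℳ hf hK hN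
  refine hS.homologyVanishes_right hℳ h1 fun j hj => (homologyVanishes_shift _).2 ?_
  exact (isGradedExact_submodule K ℳ).homologyVanishes_right hℳ (h2 j hj) fun j' hj' =>
    h3 j' (by omega)

theorem homologyVanishes_quotient_ker (h1 : HomologyVanishes k n ℳ i (μ + d))
    (h2 : HomologyVanishes k n (N.quotientGrading ℳ) (i + 1) (μ + d)) :
    HomologyVanishes k n (K.quotientGrading ℳ) i μ := by
  obtain ⟨φ, -, hS⟩ := exists_isGradedExact_smul hℳ hf hK hN
  have := (homologyVanishes_shift _).1 (hS.homologyVanishes_left hℳ h2 h1)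
  rwa [add_sub_cancel_right] at this

end smul

theorem homologyVanishes_top_induced (hℳ : IsModuleGrading (k := k) (n := n) ℳ)
    (K : Submodule (MvPolynomial (Fin n) k) M) (h : HomologyVanishes k n ℳ n μ) :
    HomologyVanishes k n (K.inducedGrading ℳ) n μ :=
  (isGradedExact_submodule K ℳ).homologyVanishes_left hℳ
    (homologyVanishes_of_lt μ (Nat.lt_succ_self n)) h

/-- A graded module that vanishes in large degrees vanishes in all degrees above its socle. -/
theorem eq_bot_of_homologyVanishes_top (hℳ : IsModuleGrading (k := k) (n := n) ℳ) {B : ℤ}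
    (hB : ∀ j, B < j → ℳ j = ⊥) {P : ℤ → Prop} (hP : Monotone P)
    (h : ∀ μ, P (μ - n) → HomologyVanishes k n ℳ n μ) {e : ℤ} (he : P e) : ℳ e = ⊥ := by
  by_contra hne
  -- In the highest nonzero degree `e'` every element lies in the socle, so `m e_{1…n}` is a cycle
  -- of internal degree `e' + n`; as there are no `(n + 1)`-chains, it bounds only if `m = 0`.
  obtain ⟨e', ⟨hee', hne'⟩, hmax⟩ := Int.exists_greatest_of_bdd (P := fun j => e ≤ j ∧ ℳ j ≠ ⊥)
    ⟨B, fun z hz => not_lt.1 fun hlt => hz.2 (hB z hlt)⟩ ⟨e, le_rfl, hne⟩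
  refine hne' ((AddSubgroup.eq_bot_iff_forall _).2 fun m hm => ?_)
  have hbot : ℳ (e' + 1) = ⊥ := by
    by_contra hcon
    have := hmax (e' + 1) ⟨by omega, hcon⟩
    omega
  have hX : ∀ j : Fin n, (X j : MvPolynomial (Fin n) k) • m = 0 := fun j => by
    have := hℳ.smul_mem 1 e' (X j) m (isHomogeneous_X k j) hm
    rwa [Nat.cast_one, hbot, AddSubgroup.mem_bot] at this
  have hc : (fun S => if S = Finset.univ then m else 0) ∈ chains n ℳ n (e' + n) := by
    refine mem_chains.2 ⟨fun S hS => if_neg fun h => hS (by simp [h]), fun S => ?_⟩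
    rw [add_sub_cancel_right]
    split_ifs
    exacts [hm, zero_mem _]
  obtain ⟨b, hb, hbm⟩ := h (e' + n) (by rw [add_sub_cancel_right]; exact hP hee' he) _ hc (by
    funext T
    rw [differential_apply]
    refine Finset.sum_eq_zero fun j _ => ?_
    split_ifs
    · rw [hX, smul_zero]
    · rw [smul_zero, smul_zero])
  rw [chains_eq_zero hb (Nat.lt_succ_self n), map_zero] at hbm
  simpa using (congrFun hbm Finset.univ).symm

end Koszul

/-! ### Homogeneous primes and parameters -/

namespace MvPolynomial

variable {k : Type u} [Field k] {n : ℕ}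

attribute [local instance] MvPolynomial.gradedAlgebra

theorem isHomogeneous_ideal_iff {σ : Type*} {I : Ideal (MvPolynomial σ k)} :
    I.IsHomogeneous (homogeneousSubmodule σ k) ↔ ∀ p ∈ I, ∀ d, homogeneousComponent d p ∈ I :=
  ⟨fun h _ hp d => homogeneousComponent_mem_of_mem h hp d, fun h d p hp => by
    have := h p hp d
    rwa [← decomposition.decompose'_apply] at this⟩

/-- The homogeneous core of `p` is a prime between `I` and `p`, so minimality makes it equal to `p`.
-/
theorem isHomogeneous_of_mem_minimalPrimes {σ : Type*} {I p : Ideal (MvPolynomial σ k)}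
    (hI : I.IsHomogeneous (homogeneousSubmodule σ k)) (hp : p ∈ I.minimalPrimes) :
    p.IsHomogeneous (homogeneousSubmodule σ k) := by
  have h1 := Ideal.toIdeal_homogeneousCore_le (homogeneousSubmodule σ k) p
  have h2 := hp.2 ⟨Ideal.IsPrime.homogeneousCore hp.1.1,
    hI.toIdeal_homogeneousCore_eq_self.symm.trans_le (Ideal.homogeneousCore_mono _ hp.1.2)⟩ h1
  rw [← le_antisymm h1 h2]
  exact (p.homogeneousCore _).isHomogeneous

theorem exists_isHomogeneous_mem_notMem {σ : Type*} {p q : Ideal (MvPolynomial σ k)}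
    (hp : p.IsHomogeneous (homogeneousSubmodule σ k)) (h : ¬ p ≤ q) :
    ∃ d f, f.IsHomogeneous d ∧ f ∈ p ∧ f ∉ q := by
  by_contra! hcon
  refine h fun f hf => ?_
  rw [← sum_homogeneousComponent f]
  exact sum_mem fun d _ => hcon d _ (homogeneousComponent_isHomogeneous d f)
    (homogeneousComponent_mem_of_mem hp hf d)

/-- Homogeneous prime avoidance for an antichain of homogeneous primes, none of which contains all
the variables. -/
theorem exists_isHomogeneous_forall_notMem {σ : Type*} (S : Finset (Ideal (MvPolynomial σ k)))
    (hprime : ∀ p ∈ S, p.IsPrime)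
    (hhom : ∀ p ∈ S, p.IsHomogeneous (homogeneousSubmodule σ k))
    (hanti : ∀ p ∈ S, ∀ q ∈ S, p ≤ q → p = q) (hX : ∀ p ∈ S, ∃ j : σ, X j ∉ p) :
    ∃ d f, d ≠ 0 ∧ f.IsHomogeneous d ∧ ∀ p ∈ S, f ∉ p := by
  classical
  induction S using Finset.induction_on with
  | empty => exact ⟨1, 0, one_ne_zero, isHomogeneous_zero _ _ _, by simp⟩
  | insert p S hpS ih =>
    obtain ⟨d, f, hd, hf, hfS⟩ := ih (fun q hq => hprime q (by simp [hq]))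
      (fun q hq => hhom q (by simp [hq]))
      (fun q hq q' hq' => hanti q (by simp [hq]) q' (by simp [hq'])) fun q hq => hX q (by simp [hq])
    by_cases hfp : f ∈ p
    swap
    · exact ⟨d, f, hd, hf, by simpa [hfp] using hfS⟩
    have := hprime p (by simp)
    have hg : ∀ q : S, ∃ e g, g.IsHomogeneous e ∧ g ∈ (q : Ideal (MvPolynomial σ k)) ∧ g ∉ p :=
      fun q => exists_isHomogeneous_mem_notMem (hhom q (by simp)) fun hle =>
        hpS (hanti q (by simp) p (by simp) hle ▸ q.2)
    choose e g hge hgq hgp using hg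
    obtain ⟨j, hj⟩ := hX p (by simp)
    have hG : (X j * ∏ q, g q).IsHomogeneous (1 + ∑ q, e q) :=
      (isHomogeneous_X k j).mul (IsHomogeneous.prod _ _ _ fun q _ => hge q)
    -- The exponents equalize the degrees of the two summands. At `p` only the first summand lies in
    -- the prime, at the earlier primes only the second. The factor `X j` keeps the degree of the
    -- second base positive even when there are no earlier primes.
    refine ⟨d * (1 + ∑ q, e q), f ^ (1 + ∑ q, e q) + (X j * ∏ q, g q) ^ d,
      mul_ne_zero hd (by omega), (hf.pow _).add (mul_comm d _ ▸ hG.pow d), fun q hq => ?_⟩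
    rcases Finset.mem_insert.1 hq with rfl | hq
    · rw [Ideal.add_mem_iff_right _ (Ideal.pow_mem_of_mem _ hfp _ (by omega))]
      intro h
      rcases this.mem_or_mem (this.mem_of_pow_mem _ h) with h | h
      · exact hj h
      · obtain ⟨q, -, hq⟩ := this.prod_mem_iff.1 h
        exact hgp q hq
    · have hqp := hprime q (by simp [hq])
      rw [Ideal.add_mem_iff_left]
      · exact fun h => hfS q hq (hqp.mem_of_pow_mem _ h)
      · refine Ideal.pow_mem_of_mem _ (Ideal.mul_mem_left _ _ ?_) _ (Nat.pos_of_ne_zero hd)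
        exact hqp.prod_mem_iff.2 ⟨⟨q, hq⟩, Finset.mem_univ _, hgq ⟨q, hq⟩⟩

theorem le_ker_constantCoeff {σ : Type*} {I : Ideal (MvPolynomial σ k)}
    (hI : I.IsHomogeneous (homogeneousSubmodule σ k)) (h : I ≠ ⊤) :
    I ≤ RingHom.ker (constantCoeff : MvPolynomial σ k →+* k) := by
  intro p hp
  by_contra hne
  have h0 := homogeneousComponent_mem_of_mem hI hp 0
  rw [homogeneousComponent_zero] at h0
  exact h (Ideal.eq_top_of_isUnit_mem _ h0 ((IsUnit.mk0 (coeff 0 p) hne).map C))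

/-- A homogeneous ideal `I` with `dim A/I ≤ 1` has a homogeneous parameter. -/
theorem exists_isHomogeneous_X_mem_radical {I : Ideal (MvPolynomial (Fin n) k)}
    (hI : I.IsHomogeneous (homogeneousSubmodule (Fin n) k))
    (hdim : ringKrullDim (MvPolynomial (Fin n) k ⧸ I) ≤ 1) :
    ∃ d f, d ≠ 0 ∧ f.IsHomogeneous d ∧ ∀ j, X j ∈ (I ⊔ Ideal.span {f}).radical := by
  -- Minimal primes containing all the variables need not, and cannot, be avoided by a form of
  -- positive degree.
  have hfin : {p ∈ I.minimalPrimes | ∃ j, X j ∉ p}.Finite :=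
    (I.finite_minimalPrimes_of_isNoetherianRing).subset (Set.sep_subset _ _)
  obtain ⟨d, f, hd, hf, hfS⟩ := exists_isHomogeneous_forall_notMem hfin.toFinset
    (fun p hp => (hfin.mem_toFinset.1 hp).1.1.1)
    (fun p hp => isHomogeneous_of_mem_minimalPrimes hI (hfin.mem_toFinset.1 hp).1)
    (fun p hp q hq hpq => le_antisymm hpq ((hfin.mem_toFinset.1 hq).1.2
      (hfin.mem_toFinset.1 hp).1.1 hpq))
    (fun p hp => (hfin.mem_toFinset.1 hp).2)
  refine ⟨d, f, hd, hf, fun j => ?_⟩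
  have hJ : (I ⊔ Ideal.span {f}).IsHomogeneous (homogeneousSubmodule (Fin n) k) :=
    hI.sup (Ideal.homogeneous_span _ _ (by rintro _ rfl; exact ⟨d, hf⟩))
  rw [← Ideal.sInf_minimalPrimes, Submodule.mem_sInf]
  intro (Q : Ideal _) hQ
  by_contra hjQ
  have hQp : Q.IsPrime := hQ.1.1
  have hIQ : I ≤ Q := le_sup_left.trans hQ.1.2
  have hfQ : f ∈ Q := (le_sup_right.trans hQ.1.2) (Ideal.mem_span_singleton_self f)
  obtain ⟨p, hp, hpQ⟩ := Ideal.exists_minimalPrimes_le hIQ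
  have hfp : f ∉ p := hfS p (hfin.mem_toFinset.2 ⟨hp, j, fun h => hjQ (hpQ h)⟩)
  have hQm := le_ker_constantCoeff (isHomogeneous_of_mem_minimalPrimes hJ hQ) hQp.ne_top
  have hm : (RingHom.ker (constantCoeff : MvPolynomial (Fin n) k →+* k)).IsPrime :=
    RingHom.ker_isPrime _
  -- A prime `Q ⊇ I + (f)` missing `X j` would give a chain `p < Q < (x₁, …, xₙ)` of length two
  -- above `I`.
  let s : LTSeries (PrimeSpectrum.zeroLocus (R := MvPolynomial (Fin n) k) I) :=
    { length := 2
      toFun := ![⟨⟨p, hp.1.1⟩, hp.1.2⟩, ⟨⟨Q, hQp⟩, hIQ⟩, ⟨⟨_, hm⟩, hIQ.trans hQm⟩]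
      step := by
        intro i
        fin_cases i
        · exact lt_of_le_not_ge hpQ fun h => hfp (h hfQ)
        · exact lt_of_le_not_ge hQm fun h => hjQ (h (by simp [RingHom.mem_ker])) }
  have h2 := (Order.LTSeries.length_le_krullDim s).trans ((ringKrullDim_quotient I).symm.trans_le hdim)
  exact absurd (show 2 ≤ 1 by exact_mod_cast h2) (by norm_num)

end MvPolynomial

/-! ### Modules of dimension at most one -/

namespace IsModuleGrading

variable {k : Type u} [Field k] {n : ℕ} {M : Type v} [AddCommGroup M]
  [Module (MvPolynomial (Fin n) k) M] {ℳ : ℤ → AddSubgroup M}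

/-- A finitely generated graded module annihilated by powers of all the variables vanishes in
large degrees. -/
theorem exists_forall_eq_bot [Module.Finite (MvPolynomial (Fin n) k) M]
    (hℳ : IsModuleGrading (k := k) (n := n) ℳ)
    (hX : ∀ j, (X j : MvPolynomial (Fin n) k) ∈ (Module.annihilator _ M).radical) :
    ∃ B, ∀ j, B < j → ℳ j = ⊥ := by
  obtain ⟨N, hN⟩ := Ideal.exists_pow_le_of_le_radical_of_fg
    (Ideal.span_le.2 (Set.range_subset_iff.2 hX)) (idealOfVars_fg (Fin n) k)
  let s : ℕ →o Submodule (MvPolynomial (Fin n) k) M :=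
    ⟨fun b => Submodule.span _ (⋃ i ≤ (b : ℤ), ℳ i), fun a b hab => Submodule.span_mono
      (Set.biUnion_mono (fun i (hi : i ≤ (a : ℤ)) => hi.trans (by exact_mod_cast hab))
        fun _ _ => le_rfl)⟩
  -- By noetherianity, `M` is generated in degrees at most `B`.
  obtain ⟨B, hB⟩ := monotone_stabilizes_iff_noetherian.2 (inferInstanceAs
    (IsNoetherian (MvPolynomial (Fin n) k) M)) s
  have htop : ∀ x, x ∈ s B := fun x => by
    refine hℳ.isInternal.induction_on x (zero_mem _) (fun i y hy => ?_) fun _ _ => add_mem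
    rw [hB (max B i.toNat) (le_max_left _ _)]
    exact Submodule.subset_span (Set.mem_biUnion (show i ≤ ((max B i.toNat : ℕ) : ℤ) by omega) hy)
  refine ⟨B + N, fun j hj => (AddSubgroup.eq_bot_iff_forall _).2 fun m hm => ?_⟩
  -- Quantifying over `p` makes the claim stable under scalars in the span induction. In degree `j >
  -- B + N` only components of `p` of degree above `N` contribute, and these annihilate `M`.
  suffices h : ∀ p : MvPolynomial (Fin n) k, hℳ.component j (p • m) = 0 by
    simpa [hℳ.isInternal.component_of_mem hm] using h 1
  refine Submodule.span_induction (p := fun m _ => ∀ p : MvPolynomial (Fin n) k,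
    hℳ.component j (p • m) = 0) (fun y hy p => ?_) (by simp)
    (fun x y _ _ hx hy p => by rw [smul_add, map_add, hx, hy, add_zero])
    (fun q x _ hx p => by rw [smul_smul, hx]) (htop m)
  obtain ⟨i, hi, hy⟩ := Set.mem_iUnion₂.1 hy
  rw [← sum_homogeneousComponent p, Finset.sum_smul, map_sum]
  refine Finset.sum_eq_zero fun d _ => ?_
  have hd := homogeneousComponent_isHomogeneous d p
  by_cases hij : i + d = j
  · have : homogeneousComponent d p ∈ Module.annihilator (MvPolynomial (Fin n) k) M := by
      refine hN ((mem_pow_idealOfVars_iff _ _).2 fun x hx => ?_)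
      have : x.degree = d := by
        rw [Finsupp.degree_eq_weight_one]; exact hd (mem_support_iff.1 hx)
      omega
    rw [Module.mem_annihilator.1 this, map_zero]
  · exact hℳ.isInternal.component_of_mem_ne (hℳ.smul_mem d i _ y hd hy) hij

end IsModuleGrading

/-- `P` stands for the degrees above a bound; an upward closed set also covers the bounds `±∞`. -/
theorem Koszul.homologyVanishes_of_ringKrullDim_le_one {k : Type u} [Field k] {n : ℕ} {M : Type v}
    [AddCommGroup M] [Module (MvPolynomial (Fin n) k) M]
    [Module.Finite (MvPolynomial (Fin n) k) M] {ℳ : ℤ → AddSubgroup M}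
    (hℳ : IsModuleGrading (k := k) (n := n) ℳ)
    (hdim : ringKrullDim (MvPolynomial (Fin n) k ⧸
      Module.annihilator (MvPolynomial (Fin n) k) M) ≤ 1)
    {P : ℤ → Prop} (hP : Monotone P)
    (h1 : ∀ μ, P (μ - n) → HomologyVanishes k n ℳ n μ)
    (h2 : ∀ j, j + 1 = n → ∀ μ, P (μ - j) → HomologyVanishes k n ℳ j μ) (i : ℕ) (μ : ℤ)
    (hμ : P (μ - i)) : HomologyVanishes k n ℳ i μ := by
  obtain ⟨d, f, hd, hf, hrad⟩ := exists_isHomogeneous_X_mem_radical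
    (isHomogeneous_ideal_iff.2 fun p hp => hℳ.annihilator_homogeneousComponent hp) hdim
  let K := LinearMap.ker (LinearMap.lsmul (MvPolynomial (Fin n) k) M f)
  let N := LinearMap.range (LinearMap.lsmul (MvPolynomial (Fin n) k) M f)
  have hK : ∀ m, m ∈ K ↔ f • m = 0 := fun m => Iff.rfl
  have hN : ∀ m, m ∈ N ↔ ∃ x, f • x = m := fun m => Iff.rfl
  have hKg := hℳ.inducedGrading K (hℳ.component_mem_of_mem_iff_smul_eq_zero hf hK)
  have hNg := hℳ.quotientGrading N (hℳ.component_mem_of_mem_iff_exists_smul hf hN)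
  obtain ⟨B, hB⟩ := hKg.exists_forall_eq_bot fun j => Ideal.radical_mono (sup_le
    (LinearMap.annihilator_le_of_injective K.subtype K.injective_subtype)
    ((Ideal.span_singleton_le_iff_mem _).2 (Module.mem_annihilator.2 fun m =>
      Subtype.ext ((hK m).1 m.2)))) (hrad j)
  obtain ⟨B', hB'⟩ := hNg.exists_forall_eq_bot fun j => Ideal.radical_mono (sup_le
    (LinearMap.annihilator_le_of_surjective N.mkQ N.mkQ_surjective)
    ((Ideal.span_singleton_le_iff_mem _).2 (Module.mem_annihilator.2 fun m => by
      obtain ⟨m, rfl⟩ := N.mkQ_surjective m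
      exact (Submodule.Quotient.mk_eq_zero N).2 ⟨m, rfl⟩))) (hrad j)
  have hKbot : ∀ e, P e → K.inducedGrading ℳ e = ⊥ := fun e he =>
    eq_bot_of_homologyVanishes_top hKg hB hP
      (fun μ hμ => homologyVanishes_top_induced hℳ K (h1 μ hμ)) he
  -- The shift is forced by `H_{n-1}(M)_{μ-d}`, for which `(μ - d) - (n - 1) = (μ - n) - d + 1`. It
  -- is also what the final criterion needs: `e = μ + d - (i + 1)` gives `e - d + 1 = μ - i`.
  have hNbot : ∀ e, P (e - d + 1) → N.quotientGrading ℳ e = ⊥ := fun e he => by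
    refine eq_bot_of_homologyVanishes_top hNg hB' (P := fun e => P (e - d + 1))
      (fun a b hab => hP (by omega)) (fun μ hμ => ?_) he
    refine homologyVanishes_coker hℳ hf hK hN (h1 μ (hP (by omega) hμ)) (fun j hj => ?_)
      fun j hj => homologyVanishes_of_eq_bot (hKbot _ (hP (by omega) hμ))
    exact h2 j hj _ (hP (by omega) hμ)
  refine homologyVanishes_of_ker_of_coker hℳ hf hK hN hd
    (homologyVanishes_of_eq_bot (hKbot _ hμ)) (homologyVanishes_of_eq_bot (hNbot _ ?_))
  convert hμ using 1
  push_cast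
  ring

/-! ### Regularity bounds as vanishing statements, and the theorem -/

theorem castelnuovoMumfordReg_le_iff {k : Type u} [Field k] {n : ℕ} {M : Type v}
    [AddCommGroup M] [Module (MvPolynomial (Fin n) k) M] {ℳ : ℤ → AddSubgroup M} {r : EReal} :
    castelnuovoMumfordReg k n ℳ ≤ r ↔ ∀ (i : ℕ) (μ : ℤ), r < (((μ - i : ℤ) : ℝ) : EReal) →
      Koszul.HomologyVanishes k n ℳ i μ := by
  have key : ∀ (i : ℕ) (μ : ℤ), ((μ : ℝ) : EReal) ≤ r + ((i : ℝ) : EReal) ↔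
      ¬ r < (((μ - i : ℤ) : ℝ) : EReal) := fun i μ => by
    rw [not_lt, ← EReal.sub_le_iff_le_add (.inl (EReal.coe_ne_bot _)) (.inl (EReal.coe_ne_top _)),
      ← EReal.coe_sub]
    push_cast
    rfl
  rw [castelnuovoMumfordReg, iSup_le_iff]
  refine forall_congr' fun i => ?_
  rw [EReal.sub_le_iff_le_add (.inl (EReal.coe_ne_bot _)) (.inl (EReal.coe_ne_top _)),
    Koszul.maxDegree, iSup₂_le_iff]
  refine forall_congr' fun μ => ?_
  rw [key, Koszul.nontrivial_homology_iff, not_imp_not]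

theorem lemma2p2 {k : Type u} [Field k] {n : ℕ} {M : Type v} [AddCommGroup M]
    [Module (MvPolynomial (Fin n) k) M] [Module.Finite (MvPolynomial (Fin n) k) M]
    (ℳ : ℤ → AddSubgroup M) (hℳ : IsModuleGrading (k := k) (n := n) ℳ)
    (l : MvPolynomial (Fin n) k) (hl : l.IsHomogeneous 1)
    (K : Submodule (MvPolynomial (Fin n) k) M) (hK : ∀ m : M, m ∈ K ↔ l • m = 0)
    (lM : Submodule (MvPolynomial (Fin n) k) M)
    (hlM : lM = Ideal.span {l} • (⊤ : Submodule (MvPolynomial (Fin n) k) M)) :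
    castelnuovoMumfordReg k n ℳ ≤
        max (castelnuovoMumfordReg k n (K.inducedGrading ℳ))
          (castelnuovoMumfordReg k n (lM.quotientGrading ℳ)) ∧
      (ringKrullDim (MvPolynomial (Fin n) k ⧸
          Module.annihilator (MvPolynomial (Fin n) k) K) ≤ 1 →
        castelnuovoMumfordReg k n ℳ =
          max (castelnuovoMumfordReg k n (K.inducedGrading ℳ))
            (castelnuovoMumfordReg k n (lM.quotientGrading ℳ))) := by
  have hN : ∀ m, m ∈ lM ↔ ∃ x, l • x = m := fun m => by
    rw [hlM, Submodule.ideal_span_singleton_smul, Submodule.mem_smul_pointwise_iff_exists]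
    simp
  have hmono : ∀ r : EReal, Monotone fun j : ℤ => r < ((j : ℝ) : EReal) := fun r a b hab h =>
    h.trans_le (by exact_mod_cast hab)
  have hle : castelnuovoMumfordReg k n ℳ ≤ max (castelnuovoMumfordReg k n (K.inducedGrading ℳ))
      (castelnuovoMumfordReg k n (lM.quotientGrading ℳ)) := by
    refine castelnuovoMumfordReg_le_iff.2 fun i μ h => ?_
    refine Koszul.homologyVanishes_of_ker_of_coker hℳ hl hK hN one_ne_zero
      (castelnuovoMumfordReg_le_iff.1 (le_max_left _ _) i μ h)
      (castelnuovoMumfordReg_le_iff.1 (le_max_right _ _) _ _ (hmono _ ?_ h))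
    push_cast
    omega
  refine ⟨hle, fun hdim => hle.antisymm ?_⟩
  have hM := castelnuovoMumfordReg_le_iff.1 (le_refl (castelnuovoMumfordReg k n ℳ))
  have hKg := hℳ.inducedGrading K (hℳ.component_mem_of_mem_iff_smul_eq_zero hl hK)
  have hKreg : castelnuovoMumfordReg k n (K.inducedGrading ℳ) ≤ castelnuovoMumfordReg k n ℳ := by
    refine castelnuovoMumfordReg_le_iff.2 (Koszul.homologyVanishes_of_ringKrullDim_le_one hKg hdim
      (hmono _) (fun μ h => Koszul.homologyVanishes_top_induced hℳ K (hM n μ h)) ?_)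
    rintro j rfl μ h
    refine (Koszul.isGradedExact_submodule K ℳ).homologyVanishes_left hℳ ?_ (hM j μ h)
    -- Here `n = j + 1`: `H_n(M/K)_μ` embeds in `H_n(M)_{μ+1}`, and `μ + 1 - n = μ - j`, so no
    -- degree is lost.
    exact Koszul.homologyVanishes_quotient_ker hℳ hl hK hN
      (hM _ _ (hmono _ (by push_cast; omega) h))
      (Koszul.homologyVanishes_of_lt _ (Nat.lt_succ_self _))
  refine max_le hKreg (castelnuovoMumfordReg_le_iff.2 fun i μ h => ?_)
  -- With `d = 1`, `H_{i-1}(M)_{μ-1}` sits at the same difference `μ - i`, and `H_{i-2}(K)_{μ-1}` at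
  -- `μ - i + 1`.
  refine Koszul.homologyVanishes_coker hℳ hl hK hN (hM i μ h) (fun j hj => ?_) fun j hj => ?_
  · exact hM _ _ (hmono _ (by push_cast; omega) h)
  · exact castelnuovoMumfordReg_le_iff.1 hKreg _ _ (hmono _ (by push_cast; omega) h)
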